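/- Let $p$ be a prime and let $G$ be a finite Camina $p$-group of nilpotence class $3$; that is, $G$ is a finite $p$-group of nilpotence class $3$ such that for every $g \in G \setminus G'$ the conjugacy class of $g$ is the coset $gG'$, where $G' = [G,G]$ is the derived subgroup. Put $G_3 = [G',G]$ and $H = G/G_3$. \begin{enumerate} \item If $H$ has exactly one or exactly two abelian subgroups of order $|H:H'|$, then $C_G(G') > G'$ (that is, $C_G(G')$ properly contains $G'$). \item If $H$ has exactly $p^a+1$ abelian subgroups of order $|H:H'|$ for some positive integer $a$, then either $C_G(G') > G'$ or $|G_3| \le p^{2a}$. \end{enumerate} -/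

import Mathlib

/-- A group `G` is a Camina group if the conjugacy class of `g` is the coset `gG'`
for every `g ∈ G \ G'`. -/
def IsCaminaGroup (G : Type*) [Group G] : Prop :=
  ∀ g : G, g ∉ commutator G → conjugatesOf g = (fun x => g * x) '' (commutator G : Set G)

/-- The third term `G₃ = [G', G]` of the lower central series `G = G₁ ≥ G₂ = G' ≥ G₃ ≥ ⋯`. -/
abbrev gammaThree (G : Type*) [Group G] : Subgroup G :=
  ⁅commutator G, (⊤ : Subgroup G)⁆

/-- The number of abelian subgroups of `H` whose order is `|H : H'|`. -/
noncomputable def numAbelianSubgroups (H : Type*) [Group H] : ℕ :=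
  Nat.card {A : Subgroup H // IsMulCommutative A ∧ Nat.card A = (commutator H).index}

/-
Put `V = G / G'`, `W = G' / G₃` and `Z = G₃`. Commutators induce an alternating map
`β : V × V → W` and a bilinear map `γ : W × V → Z` over `ZMod p`, related by the Jacobi identity,
and the Camina condition says that `β v` is onto for every `v ≠ 0`. The Pfaffian of the generic form
`ψ ∘ β` is then a form of degree `dim V / 2` in `dim W` variables without nontrivial zeros, so
`2 dim W ≤ dim V` by Chevalley–Warning. For a nonzero functional `f` on `Z`, the right radical of
`f ∘ γ` is isotropic for `β` by the Jacobi identity, and a dimension count gives it codimension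
`dim W`. Every such `f` therefore annihilates `γ (W, R)` for exactly one `R` among the isotropic
subspaces of codimension `dim W`, and these correspond to abelian subgroups of `H = G / G₃` of order
`|H : H'|`; let `k` be the number of the latter. If `C_G(G') = G'`, then the annihilators of the
`γ (W, R)` are proper, so they partition the dual of `Z` into at most `k` proper subgroups meeting
trivially, which forces `|Z| ≤ (k - 1) ^ 2`.
-/

section AlternatingMatrix

/-- A matrix is alternating if it is skew-symmetric with zero diagonal; in characteristic `2`
the diagonal condition has to be imposed separately. -/
structure IsAlternatingMatrix {ι R : Type*} [Ring R] (A : Matrix ι ι R) : Prop where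
  diag : ∀ i, A i i = 0
  skew : ∀ i j, A j i = -A i j

theorem IsAlternatingMatrix.map {ι R S : Type*} [Ring R] [Ring S] {A : Matrix ι ι R}
    (hA : IsAlternatingMatrix A) (f : R →+* S) : IsAlternatingMatrix (A.map f) where
  diag i := by simp [hA.diag]
  skew i j := by simp [hA.skew i j]

variable {ι κ R K : Type*} [Field K] {A : Matrix ι ι K}

/-- The Schur complement of the `2 × 2` block of an alternating matrix `A` on the rows and columns
`i`, `j`, written out entrywise: the inverse of that block has off-diagonal entries
`∓ (A i j)⁻¹`. -/
def pivotComplement (A : Matrix ι ι K) (i j : ι) :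
    Matrix {k // k ∉ Set.range ![i, j]} {k // k ∉ Set.range ![i, j]} K :=
  .of fun k l => A k l + (A k i * A j l - A k j * A i l) / A i j

theorem isAlternatingMatrix_pivotComplement (hA : IsAlternatingMatrix A) (i j : ι) :
    IsAlternatingMatrix (pivotComplement A i j) where
  diag k := by
    simp only [pivotComplement, Matrix.of_apply, hA.diag, hA.skew i k, hA.skew j k]
    ring
  skew k l := by
    simp only [pivotComplement, Matrix.of_apply, hA.skew k l, hA.skew i k, hA.skew j k,
      hA.skew i l, hA.skew j l]
    ring

variable [Fintype ι] [DecidableEq ι]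

theorem det_eq_det_submatrix_mul_det_schurComplement [Fintype κ] [DecidableEq κ] [CommRing R]
    (A : Matrix ι ι R) {s : κ → ι} (hs : Function.Injective s) [Invertible (A.submatrix s s)] :
    A.det = (A.submatrix s s).det * (A.submatrix (Subtype.val : {k // k ∉ Set.range s} → ι)
      Subtype.val - A.submatrix Subtype.val s * ⅟(A.submatrix s s) *
      A.submatrix s Subtype.val).det := by
  classical
  let e : κ ⊕ {k // k ∉ Set.range s} ≃ ι :=
    ((Equiv.ofInjective s hs).sumCongr (Equiv.refl _)).trans (Equiv.Set.sumCompl (Set.range s))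
  have hblocks : A.submatrix e e = Matrix.fromBlocks (A.submatrix s s) (A.submatrix s Subtype.val)
      (A.submatrix Subtype.val s) (A.submatrix Subtype.val Subtype.val) := by
    ext (_ | _) (_ | _) <;> rfl
  rw [← Matrix.det_fromBlocks₁₁, ← hblocks, Matrix.det_submatrix_equiv_self]

theorem IsAlternatingMatrix.det_eq_sq_mul_det_pivotComplement (hA : IsAlternatingMatrix A)
    {i j : ι} (hij : A i j ≠ 0) :
    A.det = A i j ^ 2 * (pivotComplement A i j).det := by
  have hne : i ≠ j := fun h => hij (h ▸ hA.diag i)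
  have hs : Function.Injective ![i, j] := by simpa [Fin.forall_fin_two] using hne
  have hJ : A.submatrix ![i, j] ![i, j] = !![0, A i j; -A i j, 0] := by
    ext a b
    fin_cases a <;> fin_cases b <;> simp [hA.diag, hA.skew i j]
  let hinv : Invertible (A.submatrix ![i, j] ![i, j]) :=
    ⟨!![0, -(A i j)⁻¹; (A i j)⁻¹, 0], by simp [hJ, hij, Matrix.one_fin_two],
      by simp [hJ, hij, Matrix.one_fin_two]⟩
  have hJinv : ⅟(A.submatrix ![i, j] ![i, j]) = !![0, -(A i j)⁻¹; (A i j)⁻¹, 0] := rfl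
  rw [det_eq_det_submatrix_mul_det_schurComplement A hs, hJinv]
  congr 2
  · simp [hJ, sq]
  · ext k l
    simp only [pivotComplement, Matrix.sub_apply, Matrix.mul_apply, Fin.sum_univ_two,
      Matrix.submatrix_apply, Matrix.of_apply, Matrix.cons_val_zero, Matrix.cons_val_one]
    ring

theorem IsAlternatingMatrix.isSquare_det (hA : IsAlternatingMatrix A) : IsSquare A.det := by
  induction hn : Fintype.card ι using Nat.strong_induction_on generalizing ι with
  | _ n ih =>
    by_cases h0 : A = 0
    · cases isEmpty_or_nonempty ι <;> simp [h0, Matrix.det_zero]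
    obtain ⟨i, j, hij⟩ : ∃ i j, A i j ≠ 0 := by
      by_contra! h
      exact h0 (Matrix.ext h)
    rw [hA.det_eq_sq_mul_det_pivotComplement hij]
    refine (IsSquare.sq _).mul (ih _ ?_ (isAlternatingMatrix_pivotComplement hA i j) rfl)
    exact hn ▸ Fintype.card_subtype_lt (x := i) (by simp)

theorem isSquare_of_isSquare_algebraMap [CommRing R] [IsDomain R] [IsIntegrallyClosed R]
    [Algebra R K] [IsFractionRing R K] {a : R} (h : IsSquare (algebraMap R K a)) : IsSquare a := by
  obtain ⟨r, hr⟩ := h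
  have hint : IsIntegral R (r ^ 2) := by rw [sq, ← hr]; exact isIntegral_algebraMap
  obtain ⟨f, rfl⟩ := IsIntegrallyClosed.exists_algebraMap_eq_of_isIntegral_pow two_pos hint
  exact ⟨f, IsFractionRing.injective R K (by rw [hr, map_mul])⟩

theorem IsAlternatingMatrix.isSquare_det_of_isIntegrallyClosed [CommRing R] [IsDomain R]
    [IsIntegrallyClosed R] {A : Matrix ι ι R} (hA : IsAlternatingMatrix A) : IsSquare A.det := by
  apply isSquare_of_isSquare_algebraMap (K := FractionRing R)
  rw [RingHom.map_det]
  exact (hA.map _).isSquare_det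

theorem totalDegree_det_le {σ : Type*} [CommRing R] {d : ℕ}
    {M : Matrix ι ι (MvPolynomial σ R)} (hM : ∀ i j, (M i j).totalDegree ≤ d) :
    M.det.totalDegree ≤ Fintype.card ι * d := by
  rw [Matrix.det_apply']
  refine (MvPolynomial.totalDegree_finsetSum _ _).trans (Finset.sup_le fun τ _ => ?_)
  have hsign : ((Equiv.Perm.sign τ : ℤ) : MvPolynomial σ R).totalDegree = 0 := by
    rw [← map_intCast (MvPolynomial.C : R →+* MvPolynomial σ R), MvPolynomial.totalDegree_C]
  calc _ ≤ 0 + (∏ i, M (τ i) i).totalDegree := hsign ▸ MvPolynomial.totalDegree_mul _ _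
    _ ≤ ∑ i, (M (τ i) i).totalDegree := by
      rw [zero_add]; exact MvPolynomial.totalDegree_finsetProd _ _
    _ ≤ Fintype.card ι * d := Finset.sum_le_card_nsmul _ _ d fun i _ => hM _ _

end AlternatingMatrix

section SubgroupPartition

variable {Y ι : Type*} [AddGroup Y] [Finite ι] {P : ι → AddSubgroup Y}

/- A coset `z + P i` avoiding `P i` meets every other `P j` in at most one element. -/
theorem card_lt_of_pairwise_disjoint_cover (hdisj : Pairwise fun i j => Disjoint (P i) (P j))
    (hcover : ∀ y, ∃ i, y ∈ P i) {i : ι} (hi : P i ≠ ⊤) : Nat.card (P i) < Nat.card ι := by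
  obtain ⟨z, hz⟩ : ∃ z, z ∉ P i := by simpa [AddSubgroup.eq_top_iff'] using hi
  choose idx hidx using hcover
  have hne (y : P i) : idx (z + y) ≠ i := by
    intro h
    have := hidx (z + y)
    rw [h, add_mem_cancel_right y.2] at this
    exact hz this
  have hinj : Function.Injective fun y : P i => idx (z + y) := by
    intro y y' h
    have hj : -(z + y) + (z + y') ∈ P (idx (z + y)) :=
      add_mem (neg_mem (hidx _)) ((congrArg P h).symm ▸ hidx (z + y'))
    have hsub : -(z + y) + (z + y') = ((-y + y' : P i) : Y) := by simp [add_assoc]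
    have := (AddSubgroup.disjoint_def.1 (hdisj (hne y))) (hsub ▸ hj) (-y + y').2
    exact (neg_add_eq_zero.1 (Subtype.ext this))
  have := Finite.of_injective _ hinj
  have := Fintype.ofFinite (P i)
  have := Fintype.ofFinite ι
  simp only [Nat.card_eq_fintype_card]
  exact Fintype.card_lt_of_injective_of_notMem _ hinj (b := i) fun ⟨y, hy⟩ => hne y hy

theorem card_le_sq_of_pairwise_disjoint_cover [Finite Y]
    (hdisj : Pairwise fun i j => Disjoint (P i) (P j)) (hcover : ∀ y, ∃ i, y ∈ P i)
    (hproper : ∀ i, P i ≠ ⊤) : Nat.card Y ≤ (Nat.card ι - 1) ^ 2 := by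
  classical
  have := Fintype.ofFinite Y
  have := Fintype.ofFinite ι
  let S (i : ι) : Finset Y := {y | y ∈ P i}
  have hS (i) : (S i).card < Nat.card ι := by
    rw [← Fintype.card_subtype, ← Nat.card_eq_fintype_card]
    exact card_lt_of_pairwise_disjoint_cover hdisj hcover (hproper i)
  have hzero (i) : 0 ∈ S i := by simp [S, zero_mem]
  have hnonzero : Finset.univ.erase (0 : Y) ⊆ Finset.univ.biUnion fun i => (S i).erase 0 := by
    intro y hy
    obtain ⟨i, hi⟩ := hcover y
    simpa [S, Finset.ne_of_mem_erase hy] using ⟨i, hi⟩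
  have hcard : Nat.card Y - 1 ≤ Nat.card ι * (Nat.card ι - 2) := by
    calc Nat.card Y - 1 = (Finset.univ.erase (0 : Y)).card := by simp
      _ ≤ (Finset.univ.biUnion fun i => (S i).erase 0).card := Finset.card_le_card hnonzero
      _ ≤ (Finset.univ : Finset ι).card * (Nat.card ι - 2) :=
        Finset.card_biUnion_le_card_mul _ _ _ fun i _ => by
          rw [Finset.card_erase_of_mem (hzero i)]
          have := hS i
          lia
      _ = Nat.card ι * (Nat.card ι - 2) := by simp
  obtain ⟨i, -⟩ := hcover 0
  obtain ⟨k, hk⟩ : ∃ k, Nat.card ι = k + 2 := by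
    have := hS i
    have := Finset.card_pos.2 ⟨0, hzero i⟩
    exact ⟨Nat.card ι - 2, by lia⟩
  simp only [hk, Nat.add_sub_cancel, Nat.add_one_sub_one] at hcard ⊢
  have : (k + 1) ^ 2 = (k + 2) * k + 1 := by ring
  lia

end SubgroupPartition

section AlternatingMap

open Module

variable {K V W : Type*} [Field K] [AddCommGroup V] [Module K V] [AddCommGroup W] [Module K W]
  {β : V →ₗ[K] V →ₗ[K] W}

theorem ker_compr₂_eq_bot (hsurj : ∀ x ≠ 0, Function.Surjective (β x)) {ψ : W →ₗ[K] K}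
    (hψ : ψ ≠ 0) : LinearMap.ker (β.compr₂ ψ) = ⊥ := by
  refine LinearMap.ker_eq_bot'.2 fun x hx => ?_
  by_contra hx0
  refine hψ ((LinearMap.cancel_right (hsurj x hx0)).1 ?_)
  rw [LinearMap.zero_comp]
  exact hx

section GenericForm

variable {ι κ : Type*} [Fintype κ]

/-- The Gram matrix of an alternating map `β : V × V → W` in coordinates: its entries are the linear
forms in the variables `X k` whose value at `t` is `ψ (β (b i) (b j))`, where `ψ : W → K` is the
functional with coordinates `t`. -/
noncomputable def genericGramMatrix (b : Basis ι K V) (c : Basis κ K W)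
    (β : V →ₗ[K] V →ₗ[K] W) : Matrix ι ι (MvPolynomial κ K) :=
  .of fun i j => ∑ k, MvPolynomial.C (c.repr (β (b i) (b j)) k) * MvPolynomial.X k

variable (b : Basis ι K V) (c : Basis κ K W)

theorem isAlternatingMatrix_genericGramMatrix (hβ : β.IsAlt) :
    IsAlternatingMatrix (genericGramMatrix b c β) where
  diag i := by simp [genericGramMatrix, hβ.self_eq_zero]
  skew i j := by simp [genericGramMatrix, ← hβ.neg (b i) (b j)]

theorem totalDegree_genericGramMatrix_le (i j : ι) :
    (genericGramMatrix b c β i j).totalDegree ≤ 1 := by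
  refine (MvPolynomial.totalDegree_finsetSum _ _).trans (Finset.sup_le fun k _ => ?_)
  exact (MvPolynomial.totalDegree_mul _ _).trans (by simp)

variable [Fintype ι] [DecidableEq ι]

theorem map_eval_genericGramMatrix (t : κ → K) :
    (genericGramMatrix b c β).map (MvPolynomial.eval t) =
      LinearMap.BilinForm.toMatrix b (β.compr₂ (c.constr K t)) := by
  ext i j
  simp [genericGramMatrix, Basis.constr_apply_fintype, Basis.equivFun_apply]

theorem eval_det_genericGramMatrix_eq_zero_iff [Nonempty ι]
    (hsurj : ∀ x ≠ 0, Function.Surjective (β x)) (t : κ → K) :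
    MvPolynomial.eval t (genericGramMatrix b c β).det = 0 ↔ t = 0 := by
  rw [RingHom.map_det, RingHom.mapMatrix_apply, map_eval_genericGramMatrix]
  have hzero : β.compr₂ (0 : W →ₗ[K] K) = 0 := rfl
  refine ⟨fun hdet => ?_, fun ht => by simp [ht, hzero, Matrix.det_zero]⟩
  by_contra ht
  have hψ : c.constr K t ≠ 0 := (c.constr K).map_ne_zero_iff.2 ht
  have : FiniteDimensional K V := b.finiteDimensional_of_finite
  exact (LinearMap.BilinForm.nondegenerate_iff_det_ne_zero b).1
    (LinearMap.BilinForm.nondegenerate_iff_ker_eq_bot.2 (ker_compr₂_eq_bot hsurj hψ)) hdet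

end GenericForm

/- The determinant of the generic Gram matrix is the square of its Pfaffian `f`, a form of degree at
most `dim V / 2` in `dim W` variables with no zero but the origin. -/
theorem two_mul_finrank_le_of_isAlt [Finite K] [FiniteDimensional K V] [Nontrivial V]
    [FiniteDimensional K W] (hβ : β.IsAlt) (hsurj : ∀ x ≠ 0, Function.Surjective (β x)) :
    2 * finrank K W ≤ finrank K V := by
  classical
  have := Fintype.ofFinite K
  have : Nonempty (Fin (finrank K V)) := ⟨⟨0, finrank_pos⟩⟩
  by_contra! hlt
  let A := genericGramMatrix (finBasis K V) (finBasis K W) β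
  obtain ⟨f, hf⟩ : IsSquare A.det :=
    (isAlternatingMatrix_genericGramMatrix _ _ hβ).isSquare_det_of_isIntegrallyClosed
  have hzero (t) : MvPolynomial.eval t f = 0 ↔ t = 0 := by
    rw [← mul_self_eq_zero, ← map_mul, ← hf, eval_det_genericGramMatrix_eq_zero_iff _ _ hsurj]
  have hf0 : f ≠ 0 := by
    rintro rfl
    exact one_ne_zero (congrFun ((hzero 1).1 (map_zero _)) ⟨0, by lia⟩)
  have hdeg : f.totalDegree < Fintype.card (Fin (finrank K W)) := by
    have hle : A.det.totalDegree ≤ Fintype.card (Fin (finrank K V)) * 1 :=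
      totalDegree_det_le (totalDegree_genericGramMatrix_le _ _)
    rw [hf, MvPolynomial.totalDegree_mul_of_isDomain hf0 hf0] at hle
    simp only [Fintype.card_fin] at hle ⊢
    lia
  have hcard : Fintype.card {t // MvPolynomial.eval t f = 0} = 1 := by
    simp [hzero]
  have hdvd := char_dvd_card_solutions (ringChar K) hdeg
  rw [hcard] at hdvd
  exact CharP.ringChar_ne_one (Nat.dvd_one.1 hdvd)

section Jacobi

variable {Z : Type*} [AddCommGroup Z] [Module K Z]

/-- The Jacobi identity for `[[x, y], z] = γ (β x y) z`, where `β` and `γ` are the first two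
brackets of a graded Lie algebra `V ⊕ W ⊕ Z` generated in degree one. -/
def JacobiIdentity (β : V →ₗ[K] V →ₗ[K] W) (γ : W →ₗ[K] V →ₗ[K] Z) : Prop :=
  ∀ x y z, γ (β x y) z + γ (β y z) x + γ (β z x) y = 0

/-- The totally isotropic subspaces for `β : V × V → W` whose codimension is the dimension
of `W`. -/
def complementaryIsotropic (β : V →ₗ[K] V →ₗ[K] W) : Set (Submodule K V) :=
  {R | (∀ x ∈ R, ∀ y ∈ R, β x y = 0) ∧ finrank K (V ⧸ R) = finrank K W}

theorem JacobiIdentity.compr₂ {γ : W →ₗ[K] V →ₗ[K] Z} (hJ : JacobiIdentity β γ) (f : Z →ₗ[K] K) :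
    JacobiIdentity β (γ.compr₂ f) := fun x y z => by
  simp only [LinearMap.compr₂_apply, ← map_add, hJ x y z, map_zero]

theorem mem_dualAnnihilator_map₂_top_iff {γ : W →ₗ[K] V →ₗ[K] Z} {f : Dual K Z}
    {R : Submodule K V} :
    f ∈ (Submodule.map₂ γ ⊤ R).dualAnnihilator ↔ R ≤ LinearMap.ker (γ.compr₂ f).flip := by
  have hker : f ∈ (Submodule.map₂ γ ⊤ R).dualAnnihilator ↔
      Submodule.map₂ γ ⊤ R ≤ LinearMap.ker f := Submodule.mem_dualAnnihilator f
  rw [hker, Submodule.map₂_le]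
  exact ⟨fun h v hv => LinearMap.ext fun w => h w trivial v hv,
    fun h w _ v hv => LinearMap.congr_fun (h hv) w⟩

variable {μ : W →ₗ[K] V →ₗ[K] K}

theorem JacobiIdentity.apply_eq_zero_of_mem_ker_flip (hJ : JacobiIdentity β μ) {x y : V}
    (hx : x ∈ LinearMap.ker μ.flip) (hy : y ∈ LinearMap.ker μ.flip) : μ (β x y) = 0 := by
  ext z
  have hx' (w) : μ w x = 0 := LinearMap.congr_fun hx w
  have hy' (w) : μ w y = 0 := LinearMap.congr_fun hy w
  simpa [hx', hy'] using hJ x y z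

/- The right radical of `μ` is totally isotropic for each symplectic form `(x, y) ↦ μ (β x y) v`. -/
theorem JacobiIdentity.two_mul_finrank_ker_flip_le [FiniteDimensional K V]
    (hJ : JacobiIdentity β μ) (hμ : μ ≠ 0) (hsurj : ∀ x ≠ 0, Function.Surjective (β x)) :
    2 * finrank K (LinearMap.ker μ.flip) ≤ finrank K V := by
  obtain ⟨v, hv⟩ : ∃ v, μ.flip v ≠ 0 := by
    by_contra! h
    exact hμ (LinearMap.ext₂ fun w v => LinearMap.congr_fun (h v) w)
  let ω : LinearMap.BilinForm K V := β.compr₂ (μ.flip v)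
  have hker : LinearMap.ker ω = ⊥ := ker_compr₂_eq_bot hsurj hv
  have hiso : LinearMap.ker μ.flip ≤ ω.orthogonal (LinearMap.ker μ.flip) := fun y hy x hx =>
    LinearMap.congr_fun (hJ.apply_eq_zero_of_mem_ker_flip hx hy) v
  have hdim := LinearMap.BilinForm.finrank_add_finrank_orthogonal' (B := ω)
    (LinearMap.ker μ.flip)
  rw [hker, inf_bot_eq, finrank_bot] at hdim
  have := Submodule.finrank_mono hiso
  lia

variable [FiniteDimensional K V] [FiniteDimensional K W]

theorem JacobiIdentity.ker_flip_mem_complementaryIsotropic [Finite K] (hJ : JacobiIdentity β μ)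
    (hμ : μ ≠ 0) (hβ : β.IsAlt) (hsurj : ∀ x ≠ 0, Function.Surjective (β x)) :
    LinearMap.ker μ.flip ∈ complementaryIsotropic β := by
  have : Nontrivial V := by
    by_contra! hV
    exact hμ (LinearMap.ext₂ fun w v => by rw [Subsingleton.elim v 0, map_zero, map_zero])
  have hdual : finrank K (Dual K W) = finrank K W := Subspace.dual_finrank_eq
  have hW := two_mul_finrank_le_of_isAlt hβ hsurj
  have hR := hJ.two_mul_finrank_ker_flip_le hμ hsurj
  have hquot := Submodule.finrank_quotient_add_finrank (LinearMap.ker μ.flip)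
  have hrank := μ.flip.finrank_range_add_finrank_ker
  have hrange := Submodule.finrank_le (LinearMap.range μ.flip)
  have honto : LinearMap.range μ.flip = ⊤ := Submodule.eq_top_of_finrank_eq (by lia)
  refine ⟨fun x hx y hy => (forall_dual_apply_eq_zero_iff K _).1 fun φ => ?_, by lia⟩
  obtain ⟨v, rfl⟩ := LinearMap.range_eq_top.1 honto φ
  exact LinearMap.congr_fun (hJ.apply_eq_zero_of_mem_ker_flip hx hy) v

variable [Finite K] {γ : W →ₗ[K] V →ₗ[K] Z}

theorem bot_notMem_complementaryIsotropic [Nontrivial V] (hβ : β.IsAlt)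
    (hsurj : ∀ x ≠ 0, Function.Surjective (β x)) : ⊥ ∉ complementaryIsotropic β := by
  rintro ⟨-, hdim⟩
  have hquot := Submodule.finrank_quotient_add_finrank (⊥ : Submodule K V)
  have hW := two_mul_finrank_le_of_isAlt hβ hsurj
  have hV : 0 < finrank K V := finrank_pos
  rw [finrank_bot] at hquot
  lia

theorem dualAnnihilator_map₂_ne_top [Nontrivial V] (hβ : β.IsAlt)
    (hsurj : ∀ x ≠ 0, Function.Surjective (β x)) (hrad : LinearMap.ker γ.flip = ⊥)
    {R : Submodule K V} (hR : R ∈ complementaryIsotropic β) :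
    (Submodule.map₂ γ ⊤ R).dualAnnihilator ≠ ⊤ := by
  rw [← Submodule.dualAnnihilator_bot, Ne, Subspace.dualAnnihilator_inj]
  intro hmap
  have hbot : R = ⊥ := by
    rw [eq_bot_iff, ← hrad]
    intro v hv
    ext w
    have := Submodule.apply_mem_map₂ γ (Submodule.mem_top (x := w)) hv
    rwa [hmap] at this
  exact bot_notMem_complementaryIsotropic hβ hsurj (hbot ▸ hR)

theorem JacobiIdentity.ker_compr₂_flip_mem_complementaryIsotropic (hJ : JacobiIdentity β γ)
    (hβ : β.IsAlt) (hsurj : ∀ x ≠ 0, Function.Surjective (β x))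
    (hspan : Submodule.map₂ γ ⊤ ⊤ = ⊤) {f : Dual K Z} (hf : f ≠ 0) :
    LinearMap.ker (γ.compr₂ f).flip ∈ complementaryIsotropic β := by
  refine (hJ.compr₂ f).ker_flip_mem_complementaryIsotropic (fun h => hf ?_) hβ hsurj
  have hmem : f ∈ (Submodule.map₂ γ ⊤ ⊤).dualAnnihilator :=
    mem_dualAnnihilator_map₂_top_iff.2 fun v _ => by rw [h]; rfl
  rwa [hspan, Submodule.dualAnnihilator_top, Submodule.mem_bot] at hmem

theorem JacobiIdentity.eq_ker_compr₂_flip (hJ : JacobiIdentity β γ) (hβ : β.IsAlt)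
    (hsurj : ∀ x ≠ 0, Function.Surjective (β x)) (hspan : Submodule.map₂ γ ⊤ ⊤ = ⊤)
    {f : Dual K Z} (hf : f ≠ 0) {R : Submodule K V} (hR : R ∈ complementaryIsotropic β)
    (hfR : f ∈ (Submodule.map₂ γ ⊤ R).dualAnnihilator) :
    R = LinearMap.ker (γ.compr₂ f).flip := by
  have hker := hJ.ker_compr₂_flip_mem_complementaryIsotropic hβ hsurj hspan hf
  refine Submodule.eq_of_le_of_finrank_eq (mem_dualAnnihilator_map₂_top_iff.1 hfR) ?_
  have hR' := Submodule.finrank_quotient_add_finrank R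
  have hker' := Submodule.finrank_quotient_add_finrank (LinearMap.ker (γ.compr₂ f).flip)
  rw [hR.2] at hR'
  rw [hker.2] at hker'
  lia

theorem JacobiIdentity.natCard_le [FiniteDimensional K Z] [Nontrivial Z]
    (hJ : JacobiIdentity β γ) (hβ : β.IsAlt) (hsurj : ∀ x ≠ 0, Function.Surjective (β x))
    (hspan : Submodule.map₂ γ ⊤ ⊤ = ⊤) (hrad : LinearMap.ker γ.flip = ⊥) :
    Nat.card Z ≤ (Nat.card (complementaryIsotropic β) - 1) ^ 2 := by
  have : Finite V := Module.finite_of_finite K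
  have : Finite (Dual K Z) := Module.finite_of_finite K
  have : Nontrivial V := by
    by_contra! hV
    have hbot : Submodule.map₂ γ ⊤ ⊤ = ⊥ := by
      rw [Subsingleton.elim (⊤ : Submodule K V) ⊥, Submodule.map₂_bot_right]
    exact bot_ne_top (hbot.symm.trans hspan)
  have hcard : Nat.card Z = Nat.card (Dual K Z) := by
    rw [natCard_eq_pow_finrank (K := K), natCard_eq_pow_finrank (K := K) (V := Dual K Z),
      Subspace.dual_finrank_eq]
  rw [hcard]
  refine card_le_sq_of_pairwise_disjoint_cover
    (P := fun R : complementaryIsotropic β =>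
      (Submodule.map₂ γ ⊤ R.1).dualAnnihilator.toAddSubgroup) ?_ ?_ ?_
  · refine fun R R' hne => AddSubgroup.disjoint_def.2 fun {f} hf hf' => ?_
    by_contra hf0
    exact hne (Subtype.ext ((hJ.eq_ker_compr₂_flip hβ hsurj hspan hf0 R.2 hf).trans
      (hJ.eq_ker_compr₂_flip hβ hsurj hspan hf0 R'.2 hf').symm))
  · have hcover {f : Dual K Z} (hf : f ≠ 0) : ∃ R : complementaryIsotropic β,
        f ∈ (Submodule.map₂ γ ⊤ R.1).dualAnnihilator :=
      ⟨⟨_, hJ.ker_compr₂_flip_mem_complementaryIsotropic hβ hsurj hspan hf⟩,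
        mem_dualAnnihilator_map₂_top_iff.2 le_rfl⟩
    intro f
    by_cases hf : f = 0
    · obtain ⟨g, hg⟩ := exists_ne (0 : Dual K Z)
      obtain ⟨R, -⟩ := hcover hg
      exact ⟨R, hf ▸ zero_mem _⟩
    · exact hcover hf
  · intro R htop
    exact dualAnnihilator_map₂_ne_top hβ hsurj hrad R.2 (Submodule.toAddSubgroup_injective htop)

end Jacobi

end AlternatingMap

section LowerCentralFactor

open scoped commutatorElement

variable {G : Type*} [Group G]

/-- The quotient `N / [N, G]`; for `N` a term of the lower central series it is the corresponding
factor of the series. -/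
abbrev LowerCentralFactor (N : Subgroup G) : Type _ :=
  N ⧸ ⁅N, (⊤ : Subgroup G)⁆.subgroupOf N

variable {N : Subgroup G}

theorem lowerCentralFactor_mk_conj [N.Normal] (c : N) (g : G) :
    ((⟨g * c * g⁻¹, Subgroup.Normal.conj_mem ‹_› c.1 c.2 g⟩ : N) : LowerCentralFactor N) = c := by
  rw [QuotientGroup.eq_iff_div_mem, Subgroup.mem_subgroupOf, ← inv_mem_iff]
  convert Subgroup.commutator_mem_commutator c.2 (Subgroup.mem_top g) using 1
  simp [commutatorElement_def, div_eq_mul_inv, mul_assoc]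

instance LowerCentralFactor.commGroup [N.Normal] : CommGroup (LowerCentralFactor N) where
  mul_comm := by
    rintro ⟨x⟩ ⟨y⟩
    refine (lowerCentralFactor_mk_conj (x * y) (x : G)⁻¹).symm.trans ?_
    exact congrArg _ (Subtype.ext (by simp))

/-- The commutator of an element of `N` with an element of `G`, as an element of `[N, G]`. -/
def commutatorElt (n : N) (g : G) : (⁅N, ⊤⁆ : Subgroup G) :=
  ⟨⁅(n : G), g⁆, Subgroup.commutator_mem_commutator n.2 (Subgroup.mem_top g)⟩

variable [N.Normal]

theorem mk_commutatorElt_mul_left (m n : N) (g : G) :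
    (commutatorElt (m * n) g : LowerCentralFactor ⁅N, (⊤ : Subgroup G)⁆) =
      commutatorElt m g * commutatorElt n g := by
  rw [mul_comm, ← lowerCentralFactor_mk_conj (commutatorElt n g) m, ← QuotientGroup.mk_mul]
  exact congrArg _ (Subtype.ext (commutatorElement_mul_left_eq_conj_mul _ _ _))

theorem mk_commutatorElt_mul_right (n : N) (g h : G) :
    (commutatorElt n (g * h) : LowerCentralFactor ⁅N, (⊤ : Subgroup G)⁆) =
      commutatorElt n g * commutatorElt n h := by
  rw [← lowerCentralFactor_mk_conj (commutatorElt n h) g, ← QuotientGroup.mk_mul]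
  exact congrArg _ (Subtype.ext (by
    simp [commutatorElt, commutatorElement_mul_right_eq_mul_conj, mul_assoc]))

variable (N) in
/-- The commutator as a bihomomorphism `N × G / G' → [N, G] / [N, G, G]`. -/
def commutatorHom : N →* Abelianization G →* LowerCentralFactor ⁅N, (⊤ : Subgroup G)⁆ :=
  .mk' (fun n => Abelianization.lift (.mk' (fun g => ↑(commutatorElt n g))
    (mk_commutatorElt_mul_right n))) fun m n => Abelianization.hom_ext _ _ <|
      MonoidHom.ext fun g => mk_commutatorElt_mul_left m n g

variable (N) in
/-- The bihomomorphism `N / [N, G] × G / G' → [N, G] / [N, G, G]` induced by `commutatorHom`. -/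
def lowerCentralPairing :
    LowerCentralFactor N →* Abelianization G →* LowerCentralFactor ⁅N, (⊤ : Subgroup G)⁆ :=
  QuotientGroup.lift _ (commutatorHom N) fun c hc => Abelianization.hom_ext _ _ <|
    MonoidHom.ext fun g => (QuotientGroup.eq_one_iff (commutatorElt c g)).2 <|
      Subgroup.mem_subgroupOf.2 <| Subgroup.commutator_mem_commutator hc (Subgroup.mem_top g)

theorem eq_top_of_lowerCentralPairing_mem
    {S : Subgroup (LowerCentralFactor ⁅N, (⊤ : Subgroup G)⁆)}
    (hS : ∀ q v, lowerCentralPairing N q v ∈ S) : S = ⊤ := by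
  have hle : ⁅N, (⊤ : Subgroup G)⁆ ≤ (S.comap (QuotientGroup.mk' _)).map (Subgroup.subtype _) :=
    Subgroup.commutator_le.2 fun n hn g _ =>
      ⟨commutatorElt ⟨n, hn⟩ g, hS (⟨n, hn⟩ : N) (.of g), rfl⟩
  refine (Subgroup.eq_top_iff' S).2 (QuotientGroup.mk_surjective.forall.2 fun c => ?_)
  obtain ⟨d, hd, hdc⟩ := hle c.2
  rwa [← Subtype.ext hdc]

variable (G) in
/-- The commutator as a bihomomorphism `G / G' × G / G' → G' / G₃`. -/
def abelianizationPairing :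
    Abelianization G →* Abelianization G →* LowerCentralFactor (commutator G) :=
  Abelianization.lift ((commutatorHom (⊤ : Subgroup G)).comp Subgroup.topEquiv.symm.toMonoidHom)

theorem abelianizationPairing_of (g h : G) :
    abelianizationPairing G (.of g) (.of h) =
      ((⟨⁅g, h⁆, Subgroup.commutator_mem_commutator trivial trivial⟩ : commutator G) :
        LowerCentralFactor (commutator G)) := rfl

theorem abelianizationPairing_self (v : Abelianization G) : abelianizationPairing G v v = 1 := by
  obtain ⟨g, rfl⟩ := QuotientGroup.mk_surjective v
  exact congrArg _ (Subtype.ext (commutatorElement_self g))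

theorem lowerCentralPairing_hallWitt (a b c : G) :
    lowerCentralPairing (commutator G) (abelianizationPairing G (.of a⁻¹) (.of b)) (.of c) *
      lowerCentralPairing (commutator G) (abelianizationPairing G (.of c⁻¹) (.of a)) (.of b) *
      lowerCentralPairing (commutator G) (abelianizationPairing G (.of b⁻¹) (.of c)) (.of a) =
        1 := by
  let t (a b c : G) : gammaThree G :=
    commutatorElt (commutatorElt (N := ⊤) ⟨a, trivial⟩ b : commutator G) c
  have ht (a b c : G) : (t a b c : G) = ⁅⁅a, b⁆, c⁆ := rfl
  change (t a⁻¹ b c : LowerCentralFactor (gammaThree G)) * t c⁻¹ a b * t b⁻¹ c a = 1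
  rw [← lowerCentralFactor_mk_conj (t a⁻¹ b c) a, ← lowerCentralFactor_mk_conj (t c⁻¹ a b) c,
    ← lowerCentralFactor_mk_conj (t b⁻¹ c a) b, ← QuotientGroup.mk_mul, ← QuotientGroup.mk_mul,
    ← QuotientGroup.mk_one]
  refine congrArg _ (Subtype.ext ?_)
  simpa [ht, mul_assoc] using conj_commutatorElement_left_commutatorElement_mul a b c

theorem lowerCentralPairing_jacobi (x y z : Abelianization G) :
    lowerCentralPairing (commutator G) (abelianizationPairing G x y) z *
      lowerCentralPairing (commutator G) (abelianizationPairing G y z) x *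
      lowerCentralPairing (commutator G) (abelianizationPairing G z x) y = 1 := by
  obtain ⟨a, rfl⟩ := QuotientGroup.mk_surjective x
  obtain ⟨b, rfl⟩ := QuotientGroup.mk_surjective y
  obtain ⟨c, rfl⟩ := QuotientGroup.mk_surjective z
  have h := lowerCentralPairing_hallWitt a b c
  simp only [map_inv, MonoidHom.inv_apply, ← mul_inv, inv_eq_one] at h
  rwa [mul_right_comm] at h

end LowerCentralFactor

section Camina

open scoped commutatorElement

variable {G : Type*} [Group G]

theorem IsCaminaGroup.exists_commutatorElement_eq (hC : IsCaminaGroup G) {g : G}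
    (hg : g ∉ commutator G) {c : G} (hc : c ∈ commutator G) : ∃ x, ⁅g, x⁆ = c := by
  have hconj : g⁻¹ * c ∈ conjugatesOf g⁻¹ := by
    rw [hC _ (mt inv_mem_iff.1 hg)]
    exact ⟨c, hc, rfl⟩
  obtain ⟨x, hx⟩ := isConj_iff.1 hconj
  exact ⟨x, by rw [commutatorElement_def, mul_assoc, mul_assoc, ← mul_assoc x, hx,
    mul_inv_cancel_left]⟩

theorem IsCaminaGroup.abelianizationPairing_surjective (hC : IsCaminaGroup G)
    {v : Abelianization G} (hv : v ≠ 1) : Function.Surjective (abelianizationPairing G v) := by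
  obtain ⟨g, rfl⟩ := QuotientGroup.mk_surjective v
  rintro ⟨c⟩
  have hg : g ∉ commutator G := mt (QuotientGroup.eq_one_iff g).2 hv
  obtain ⟨x, hx⟩ := hC.exists_commutatorElement_eq hg c.2
  exact ⟨.of x, (abelianizationPairing_of g x).trans (congrArg _ (Subtype.ext hx))⟩

/- If `v ^ p ≠ 1`, then `w ↦ w ^ p` is onto the `p`-group `G' / G₃`, because it carries
`abelianizationPairing G v` to `abelianizationPairing G (v ^ p)`. -/
theorem IsCaminaGroup.pow_eq_one [Finite G] {p : ℕ} [Fact p.Prime] (hC : IsCaminaGroup G)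
    (hpG : IsPGroup p G) [Nontrivial (LowerCentralFactor (commutator G))] (v : Abelianization G) :
    v ^ p = 1 := by
  by_contra hv
  have honto : Function.Surjective fun w : LowerCentralFactor (commutator G) => w ^ p := by
    intro w
    obtain ⟨u, rfl⟩ := hC.abelianizationPairing_surjective hv w
    exact ⟨abelianizationPairing G v u, by rw [map_pow, MonoidHom.pow_apply]⟩
  have hdvd : p ∣ Nat.card (LowerCentralFactor (commutator G)) :=
    (((hpG.to_subgroup _).to_quotient _).card_eq_or_dvd).resolve_left Finite.one_lt_card.ne'
  obtain ⟨w, hw⟩ := exists_prime_orderOf_dvd_card' p hdvd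
  have hw1 : w = 1 := Finite.injective_iff_surjective.2 honto <| by
    simp only [one_pow, ← hw, pow_orderOf_eq_one]
  exact (Fact.out : p.Prime).ne_one (by rw [← hw, hw1, orderOf_one])

end Camina

section ElementaryAbelian

open Module

variable {A B C : Type*} [CommGroup A] [CommGroup B] [CommGroup C]

/-- The subgroups `R` with `b = 1` on `R × R` whose index is the order of the target: the
multiplicative counterpart of `complementaryIsotropic`. -/
def isotropicSubgroups (b : A →* A →* B) : Set (Subgroup A) :=
  {R | (∀ v ∈ R, ∀ w ∈ R, b v w = 1) ∧ R.index = Nat.card B}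

section Linearization

variable (p : ℕ) [Module (ZMod p) (Additive A)] [Module (ZMod p) (Additive B)]
  [Module (ZMod p) (Additive C)]

/-- A bihomomorphism of elementary abelian `p`-groups, as a bilinear map over `ZMod p`. -/
def zmodBilin (b : A →* B →* C) :
    Additive A →ₗ[ZMod p] Additive B →ₗ[ZMod p] Additive C :=
  AddMonoidHom.toZModLinearMap p <|
    .mk' (fun v => (MonoidHom.toAdditive (b v.toMul)).toZModLinearMap p) fun v w =>
      LinearMap.ext fun u => congrArg Additive.ofMul <|
        DFunLike.congr_fun (map_mul b v.toMul w.toMul) u.toMul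

variable {p}

theorem map₂_zmodBilin_eq_top {c : B →* A →* C}
    (hspan : ∀ S : Subgroup C, (∀ w v, c w v ∈ S) → S = ⊤) :
    Submodule.map₂ (zmodBilin p c) ⊤ ⊤ = ⊤ := by
  have htop := hspan (AddSubgroup.toSubgroup' (Submodule.map₂ (zmodBilin p c) ⊤ ⊤).toAddSubgroup)
    fun w v => Submodule.apply_mem_map₂ (zmodBilin p c) (m := .ofMul w) (n := .ofMul v) trivial
      trivial
  exact (Submodule.eq_top_iff').2 fun z => htop.ge (Subgroup.mem_top z.toMul)

theorem ker_flip_zmodBilin_eq_bot {c : B →* A →* C}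
    (hrad : ∀ v, (∀ w, c w v = 1) → v = 1) : LinearMap.ker (zmodBilin p c).flip = ⊥ :=
  LinearMap.ker_eq_bot'.2 fun v hv => hrad v.toMul fun w =>
    LinearMap.congr_fun hv (Additive.ofMul w)

variable [Fact p.Prime] [Finite A] [Finite B]

theorem toSubgroup_mem_isotropicSubgroups {b : A →* A →* B}
    {R : Submodule (ZMod p) (Additive A)} (hR : R ∈ complementaryIsotropic (zmodBilin p b)) :
    AddSubgroup.toSubgroup' R.toAddSubgroup ∈ isotropicSubgroups b := by
  refine ⟨fun v hv w hw => hR.1 (.ofMul v) hv (.ofMul w) hw, ?_⟩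
  calc (AddSubgroup.toSubgroup' R.toAddSubgroup).index
      = Nat.card (Additive A ⧸ R) := rfl
    _ = Nat.card (Additive B) := by
      rw [natCard_eq_pow_finrank (K := ZMod p), hR.2, ← natCard_eq_pow_finrank]
    _ = Nat.card B := rfl

theorem natCard_complementaryIsotropic_le {b : A →* A →* B} :
    Nat.card (complementaryIsotropic (zmodBilin p b)) ≤ Nat.card (isotropicSubgroups b) :=
  Nat.card_le_card_of_injective (fun R => ⟨_, toSubgroup_mem_isotropicSubgroups R.2⟩)
    fun _ _ h => Subtype.ext <| Submodule.toAddSubgroup_injective <|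
      AddSubgroup.toSubgroup'.injective (Subtype.mk.inj h)

end Linearization

variable [Finite A] [Finite B] [Finite C] [Nontrivial C] {b : A →* A →* B} {c : B →* A →* C}

theorem natCard_le_of_zmodModule (p : ℕ) [Fact p.Prime] [Module (ZMod p) (Additive A)]
    [Module (ZMod p) (Additive B)] [Module (ZMod p) (Additive C)]
    (hself : ∀ v, b v v = 1) (hsurj : ∀ v ≠ 1, Function.Surjective (b v))
    (hjac : ∀ x y z, c (b x y) z * c (b y z) x * c (b z x) y = 1)
    (hspan : ∀ S : Subgroup C, (∀ w v, c w v ∈ S) → S = ⊤)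
    (hrad : ∀ v, (∀ w, c w v = 1) → v = 1) :
    Nat.card C ≤ (Nat.card (isotropicSubgroups b) - 1) ^ 2 := by
  have hJ : JacobiIdentity (zmodBilin p b) (zmodBilin p c) := hjac
  calc Nat.card C = Nat.card (Additive C) := rfl
    _ ≤ (Nat.card (complementaryIsotropic (zmodBilin p b)) - 1) ^ 2 :=
      hJ.natCard_le hself hsurj (map₂_zmodBilin_eq_top hspan) (ker_flip_zmodBilin_eq_bot hrad)
    _ ≤ (Nat.card (isotropicSubgroups b) - 1) ^ 2 :=
      Nat.pow_le_pow_left (Nat.sub_le_sub_right natCard_complementaryIsotropic_le 1) 2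

theorem natCard_le_of_pow_eq_one {p : ℕ} [Fact p.Prime] (hpow : ∀ v : A, v ^ p = 1)
    (hself : ∀ v, b v v = 1) (hsurj : ∀ v ≠ 1, Function.Surjective (b v))
    (hjac : ∀ x y z, c (b x y) z * c (b y z) x * c (b z x) y = 1)
    (hspan : ∀ S : Subgroup C, (∀ w v, c w v ∈ S) → S = ⊤)
    (hrad : ∀ v, (∀ w, c w v = 1) → v = 1) :
    Nat.card C ≤ (Nat.card (isotropicSubgroups b) - 1) ^ 2 := by
  obtain ⟨v, hv⟩ : ∃ v : A, v ≠ 1 := by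
    by_contra! h
    exact bot_ne_top (hspan ⊥ fun w v => Subgroup.mem_bot.2 (by rw [h v, map_one]))
  have hpowB (w : B) : w ^ p = 1 := by
    obtain ⟨u, rfl⟩ := hsurj v hv w
    rw [← map_pow, hpow, map_one]
  have hpowC (z : C) : z ^ p = 1 := by
    have htop : (powMonoidHom p : C →* C).ker = ⊤ := hspan _ fun w v => by
      rw [MonoidHom.mem_ker, powMonoidHom_apply, ← map_pow, hpow, map_one]
    exact MonoidHom.mem_ker.1 (htop.ge (Subgroup.mem_top z))
  let _ : Module (ZMod p) (Additive A) := AddCommGroup.zmodModule hpow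
  let _ : Module (ZMod p) (Additive B) := AddCommGroup.zmodModule hpowB
  let _ : Module (ZMod p) (Additive C) := AddCommGroup.zmodModule hpowC
  exact natCard_le_of_zmodModule p hself hsurj hjac hspan hrad

end ElementaryAbelian

section AbelianSubgroups

open scoped commutatorElement

variable {G : Type*} [Group G]

theorem gammaThree_le_commutator : gammaThree G ≤ commutator G :=
  Subgroup.commutator_le_left _ _

theorem index_commutator_quotient_gammaThree :
    (commutator (G ⧸ gammaThree G)).index = (commutator G).index := by
  have hmk := QuotientGroup.mk'_surjective (gammaThree G)
  have hmap : (commutator G).map (QuotientGroup.mk' (gammaThree G)) =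
      commutator (G ⧸ gammaThree G) :=
    (Subgroup.map_commutator ⊤ ⊤ _).trans (by rw [Subgroup.map_top_of_surjective _ hmk]; rfl)
  rw [← hmap, Subgroup.index_map_eq _ hmk
    ((QuotientGroup.ker_mk' _).trans_le gammaThree_le_commutator)]

theorem natCard_quotient_gammaThree :
    Nat.card (G ⧸ gammaThree G) =
      Nat.card (LowerCentralFactor (commutator G)) * (commutator G).index :=
  (Subgroup.relIndex_mul_index gammaThree_le_commutator).symm

variable (G) in
/-- The canonical map `G / G₃ → G / G'`. -/
def toAbelianization : G ⧸ gammaThree G →* Abelianization G :=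
  QuotientGroup.map _ _ (MonoidHom.id G) gammaThree_le_commutator

theorem toAbelianization_surjective : Function.Surjective (toAbelianization G) :=
  QuotientGroup.map_surjective_of_surjective _ _ _ QuotientGroup.mk_surjective _

theorem isMulCommutative_comap_toAbelianization {R : Subgroup (Abelianization G)}
    (hR : R ∈ isotropicSubgroups (abelianizationPairing G)) :
    IsMulCommutative (R.comap (toAbelianization G)) := by
  refine ⟨⟨?_⟩⟩
  rintro ⟨⟨a⟩, ha⟩ ⟨⟨b⟩, hb⟩
  have hab : ⁅a, b⁆ ∈ gammaThree G :=
    Subgroup.mem_subgroupOf.1 ((QuotientGroup.eq_one_iff _).1 (hR.1 _ ha _ hb))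
  refine Subtype.ext (commutatorElement_eq_one_iff_mul_comm.1 ?_)
  exact (QuotientGroup.eq_one_iff ⁅a, b⁆).2 hab

theorem natCard_comap_toAbelianization [Finite G] {R : Subgroup (Abelianization G)}
    (hR : R ∈ isotropicSubgroups (abelianizationPairing G)) :
    Nat.card (R.comap (toAbelianization G)) = (commutator (G ⧸ gammaThree G)).index := by
  have hmul := Subgroup.card_mul_index (R.comap (toAbelianization G))
  rw [Subgroup.index_comap_of_surjective _ toAbelianization_surjective, hR.2,
    natCard_quotient_gammaThree, mul_comm] at hmul
  rw [index_commutator_quotient_gammaThree]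
  exact Nat.eq_of_mul_eq_mul_left Nat.card_pos hmul

theorem natCard_isotropicSubgroups_le [Finite G] :
    Nat.card (isotropicSubgroups (abelianizationPairing G)) ≤
      numAbelianSubgroups (G ⧸ gammaThree G) :=
  Nat.card_le_card_of_injective
    (fun R => ⟨R.1.comap (toAbelianization G), isMulCommutative_comap_toAbelianization R.2,
      natCard_comap_toAbelianization R.2⟩)
    fun _ _ h => Subtype.ext
      (Subgroup.comap_injective toAbelianization_surjective (Subtype.mk.inj h))

end AbelianSubgroups

section ClassThree

open scoped commutatorElement

variable {G : Type*} [Group G]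

theorem commutator_le_centralizer_commutator (h4 : ⁅gammaThree G, (⊤ : Subgroup G)⁆ = ⊥) :
    commutator G ≤ Subgroup.centralizer (commutator G : Set G) := by
  refine Subgroup.commutator_eq_bot_iff_le_centralizer.1 ?_
  exact Subgroup.commutator_commutator_eq_bot_of_rotate
    (by rwa [Subgroup.commutator_comm ⊤ (commutator G)]) h4

theorem eq_one_of_lowerCentralPairing_eq_one (h4 : ⁅gammaThree G, (⊤ : Subgroup G)⁆ = ⊥)
    (hcent : Subgroup.centralizer (commutator G : Set G) ≤ commutator G) {v : Abelianization G}
    (hv : ∀ q, lowerCentralPairing (commutator G) q v = 1) : v = 1 := by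
  obtain ⟨g, rfl⟩ := QuotientGroup.mk_surjective v
  refine (QuotientGroup.eq_one_iff g).2 (hcent ?_)
  refine Subgroup.mem_centralizer_iff_commutator_eq_one.2 fun c hc => ?_
  have hmem : ⁅c, g⁆ ∈ ⁅gammaThree G, (⊤ : Subgroup G)⁆ :=
    Subgroup.mem_subgroupOf.1 ((QuotientGroup.eq_one_iff _).1 (hv (⟨c, hc⟩ : commutator G)))
  rwa [h4, Subgroup.mem_bot] at hmem

variable [Finite G] {p : ℕ} [Fact p.Prime]

theorem IsCaminaGroup.natCard_lowerCentralFactor_gammaThree_le (hC : IsCaminaGroup G)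
    (hpG : IsPGroup p G) [Nontrivial (LowerCentralFactor (gammaThree G))]
    (hrad : ∀ v, (∀ q, lowerCentralPairing (commutator G) q v = 1) → v = 1) :
    Nat.card (LowerCentralFactor (gammaThree G)) ≤
      (numAbelianSubgroups (G ⧸ gammaThree G) - 1) ^ 2 := by
  have : Nontrivial (LowerCentralFactor (commutator G)) := by
    by_contra! h
    refine bot_ne_top (α := Subgroup (LowerCentralFactor (gammaThree G)))
      (eq_top_of_lowerCentralPairing_mem fun q v => Subgroup.mem_bot.2 ?_)
    rw [Subsingleton.elim q 1, map_one, MonoidHom.one_apply]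
  calc Nat.card (LowerCentralFactor (gammaThree G))
      ≤ (Nat.card (isotropicSubgroups (abelianizationPairing G)) - 1) ^ 2 :=
        natCard_le_of_pow_eq_one (hC.pow_eq_one hpG) abelianizationPairing_self
          (fun _ => hC.abelianizationPairing_surjective) lowerCentralPairing_jacobi
          (fun _ => eq_top_of_lowerCentralPairing_mem) hrad
    _ ≤ (numAbelianSubgroups (G ⧸ gammaThree G) - 1) ^ 2 :=
        Nat.pow_le_pow_left (Nat.sub_le_sub_right natCard_isotropicSubgroups_le 1) 2

theorem IsCaminaGroup.commutator_lt_centralizer_or_natCard_gammaThree_le (hC : IsCaminaGroup G)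
    (hpG : IsPGroup p G) (h3 : gammaThree G ≠ ⊥) (h4 : ⁅gammaThree G, (⊤ : Subgroup G)⁆ = ⊥) :
    commutator G < Subgroup.centralizer (commutator G : Set G) ∨
      Nat.card (gammaThree G) ≤ (numAbelianSubgroups (G ⧸ gammaThree G) - 1) ^ 2 := by
  rw [lt_iff_le_not_ge, and_iff_right (commutator_le_centralizer_commutator h4),
    or_iff_not_imp_left, not_not]
  intro hcent
  have hcard : Nat.card (LowerCentralFactor (gammaThree G)) = Nat.card (gammaThree G) := by
    rw [← Subgroup.relIndex_bot_left, ← h4]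
    rfl
  have : Nontrivial (LowerCentralFactor (gammaThree G)) := by
    rw [← Finite.one_lt_card_iff_nontrivial, hcard]
    exact (Subgroup.one_lt_card_iff_ne_bot _).2 h3
  rw [← hcard]
  exact hC.natCard_lowerCentralFactor_gammaThree_le hpG fun _ =>
    eq_one_of_lowerCentralPairing_eq_one h4 hcent

end ClassThree

theorem theorem1p2 (p : ℕ) (hp : p.Prime) (G : Type*) [Group G] [Finite G]
    (hpG : IsPGroup p G) (hCamina : IsCaminaGroup G) (hclass : Group.nilpotencyClass G = 3) :
    ((numAbelianSubgroups (G ⧸ gammaThree G) = 1 ∨ numAbelianSubgroups (G ⧸ gammaThree G) = 2) →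
      commutator G < Subgroup.centralizer (commutator G : Set G)) ∧
    (∀ a : ℕ, 0 < a → numAbelianSubgroups (G ⧸ gammaThree G) = p ^ a + 1 →
      commutator G < Subgroup.centralizer (commutator G : Set G) ∨
        Nat.card (gammaThree G) ≤ p ^ (2 * a)) := by
  have : Fact p.Prime := ⟨hp⟩
  have : Group.IsNilpotent G := hpG.isNilpotent
  have h4 : ⁅gammaThree G, (⊤ : Subgroup G)⁆ = ⊥ :=
    (Subgroup.lowerCentralSeries_eq_bot_iff_nilpotencyClass_le (n := 3)).2 hclass.le
  have h3 : gammaThree G ≠ ⊥ := fun h => by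
    have := (Subgroup.lowerCentralSeries_eq_bot_iff_nilpotencyClass_le (G := G) (n := 2)).1 h
    lia
  have hcard : 1 < Nat.card (gammaThree G) := (Subgroup.one_lt_card_iff_ne_bot _).2 h3
  have hbound := hCamina.commutator_lt_centralizer_or_natCard_gammaThree_le hpG h3 h4
  refine ⟨fun hk => hbound.resolve_right ?_, fun a _ hk => hbound.imp_right fun hle => ?_⟩
  · rcases hk with hk | hk <;> rw [hk] <;> lia
  · rwa [hk, Nat.add_sub_cancel, ← pow_mul, mul_comm] at hle
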